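/- All graphs are finite and simple. Let $v(F)$ be the number of vertices of a graph $F$, and let $\delta(G)$ be the minimum degree of a graph $G$. A copy of $F$ in $G$ is a subgraph of $G$ isomorphic to $F$. A fractional $F$-decomposition of $G$ is an assignment $\phi$ of non-negative real weights to the copies of $F$ in $G$ such that, for every edge $e$ of $G$, the weights of the copies of $F$ containing $e$ sum to exactly $1$. The fractional $F$-decomposition threshold $\delta^*_F$ is the infimum of all $\delta\in[0,1]$ for which there is an integer $n_0$ such that, for all $n\ge n_0$, every $n$-vertex graph $G$ with $\delta(G)\ge \delta n$ has a fractional $F$-decomposition. **Theorem.** For every graph $F$ and every real $\varepsilon\in(0,1)$ there exist a real $\sigma\in(0,1)$ and an integer $C\ge 1$ such that the following holds for every sufficiently large integer $n$. If $G$ is an $n$-vertex graph with $\delta(G)\ge(\delta^*_F+\varepsilon)n$, then $G$ has a fractional $F$-decomposition $\phi$ such that $$\sigma\;\le\;\phi(H)\cdot\binom{n-2}{v(F)-2}\;\le\; C\qquad\text{for every copy } H \text{ of } F \text{ in } G.$$ -/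

import Mathlib

/-- The set of copies of `F` in `G`: the subgraphs of `G` that are isomorphic to `F`. -/
def GraphCopies {W V : Type*} (F : SimpleGraph W) (G : SimpleGraph V) : Set G.Subgraph :=
  {H | Nonempty (F ≃g H.coe)}

open Classical in
/-- A fractional `F`-decomposition of a finite graph `G`: non-negative weights on the copies of `F`
in `G` such that, for each edge `e` of `G`, the weights of the copies containing `e` sum to `1`. -/
structure IsFractionalDecomposition {W V : Type*} [Fintype V]
    (F : SimpleGraph W) (G : SimpleGraph V) (φ : GraphCopies F G → ℝ) : Prop where
  nonneg : ∀ H, 0 ≤ φ H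
  sum_eq_one : ∀ e ∈ G.edgeSet, ∑ H : GraphCopies F G with e ∈ H.1.edgeSet, φ H = 1

/-- The fractional `F`-decomposition threshold: the infimum of all `δ ∈ [0, 1]` for which there is
`n₀` such that every graph on `n ≥ n₀` vertices with minimum degree at least `δ * n` has a
fractional `F`-decomposition. -/
noncomputable def fractionalThreshold {W : Type*} (F : SimpleGraph W) : ℝ :=
  sInf {δ : ℝ | δ ∈ Set.Icc (0 : ℝ) 1 ∧
    ∃ n₀ : ℕ, ∀ n : ℕ, n₀ ≤ n → ∀ (G : SimpleGraph (Fin n)) [DecidableRel G.Adj],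
      δ * (n : ℝ) ≤ (G.minDegree : ℝ) →
        ∃ φ : GraphCopies F G → ℝ, IsFractionalDecomposition F G φ}

/-- A weighting of the copies of `F` in the `n`-vertex graph `G` is `(σ, C)`-balanced if
`φ(H) * binom(n - 2, v(F) - 2) ∈ [σ, C]` for every copy `H` of `F` in `G`. -/
def IsBalanced {W V : Type*} [Fintype W] [Fintype V] (F : SimpleGraph W) (G : SimpleGraph V)
    (σ C : ℝ) (φ : GraphCopies F G → ℝ) : Prop :=
  ∀ H, φ H * ((Fintype.card V - 2).choose (Fintype.card W - 2) : ℝ) ∈ Set.Icc σ C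

/-!
The proof samples `G` by injections `g : Fin m ↪ Fin n` with `m` a large constant, decomposes the
sampled graphs `G.comap g`, and averages the results. It works with labelled copies, that is,
injections `f : W ↪ V` whose image `F.copyAlong f` lies in `G`; forgetting the labelling costs a
factor between `1` and `k ^ k`, where `k = v(F)`.

*Samples.* If `G` has minimum degree at least `p * n` with `p = δ* + ε`, then, for every set `A` of
at most `k` coordinates and every injective prescription of `g` on `A`, all but a proportion `κ` of
the maps `g : Fin m → Fin n` with that prescription are injective and have
`δ(G.comap g) ≥ (p - ε / 2) * m` (`card_goodEmbeddings_extending_ge`). Collisions are rare because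
`n` is large, and low degrees are rare by an exponential moment bound, so that `κ` can be made
smaller than any prescribed power of `1 / m` (`exists_sampleSize`).

*Decomposing one sample.* A graph `G'` on `m` vertices with this minimum degree keeps a fractional
decomposition after the deletion of edges spanned by at most `k` vertices. Adding back a deleted
copy gives a decomposition in which that copy has weight at least `1`. Averaging these over all
`L ≤ m ^ k` injections `W ↪ Fin m` (with any decomposition of `G'` for the injections that are not
copies) makes the weight of every copy at least `1 / L`. Subtracting the decomposition of `G' - e`
from that of `G'` gives a signed weighting whose total is `1` on `e` and `0` on every other edge.
Hence every prescription of edge totals sufficiently close to `1` is met by weights that are all at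
least `1 / (2 * L)` and at most `2` (`DecomposesAbove.exists_weighted`).

*Averaging.* Every edge of `G` lies in almost the same number of good samples, up to a factor
`1 - κ`. Prescribing in each sample the edge totals inversely proportional to these numbers makes
the average over all good samples an exact decomposition of `G`. Each copy of `F` lies in
`Θ(n ^ (m - k))` good samples and the normalization is `Θ(n ^ (m - 2))`, so that its weight is
`Θ(n ^ (2 - k))` (`exists_labelledDecomposition_of_sample`).

If `F` has no edges, its threshold is `1` and no graph satisfies the degree condition.
-/

/-! ### Labelled copies -/

/-- The image of the pattern `F` under the injection `f`, as a graph on the whole vertex set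
`V`. -/
def SimpleGraph.copyAlong {W V : Type*} (F : SimpleGraph W) (f : W ↪ V) : SimpleGraph V :=
  F.map f

theorem SimpleGraph.copyAlong_adj {W V : Type*} {F : SimpleGraph W} {f : W ↪ V} {x y : V} :
    (F.copyAlong f).Adj x y ↔ ∃ u v, F.Adj u v ∧ f u = x ∧ f v = y :=
  SimpleGraph.map_adj f F x y

/-- The injection `f` labels the copy `H` of `F`: it maps the vertices and edges of `F` onto those
of `H`. -/
structure IsLabelling {W V : Type*} {F : SimpleGraph W} {G : SimpleGraph V} (f : W ↪ V)
    (H : GraphCopies F G) : Prop where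
  verts_eq : H.1.verts = Set.range f
  adj_iff : ∀ x y, H.1.Adj x y ↔ (F.copyAlong f).Adj x y

theorem exists_isLabelling {W V : Type*} {F : SimpleGraph W} {G : SimpleGraph V}
    (H : GraphCopies F G) : ∃ f : W ↪ V, IsLabelling f H := by
  obtain ⟨H, ⟨i⟩⟩ := H
  refine ⟨i.toEquiv.toEmbedding.trans (Function.Embedding.subtype _), ?_, fun x y => ?_⟩
  · ext x
    constructor
    · exact fun hx => ⟨i.symm ⟨x, hx⟩, by simp⟩
    · rintro ⟨u, rfl⟩
      exact (i u).2
  · rw [SimpleGraph.copyAlong_adj]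
    constructor
    · intro hxy
      refine ⟨i.symm ⟨x, H.edge_vert hxy⟩, i.symm ⟨y, H.edge_vert hxy.symm⟩, ?_, ?_, ?_⟩
      · rw [SimpleGraph.Iso.map_adj_iff]; exact hxy
      · simp
      · simp
    · rintro ⟨u, v, huv, rfl, rfl⟩
      exact i.map_adj_iff.2 huv

theorem IsLabelling.copyAlong_le {W V : Type*} {F : SimpleGraph W} {G : SimpleGraph V}
    {f : W ↪ V} {H : GraphCopies F G} (h : IsLabelling f H) : F.copyAlong f ≤ G :=
  fun x y hxy => H.1.adj_sub ((h.adj_iff x y).2 hxy)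

theorem IsLabelling.unique {W V : Type*} {F : SimpleGraph W} {G : SimpleGraph V}
    {f : W ↪ V} {H H' : GraphCopies F G} (h : IsLabelling f H) (h' : IsLabelling f H') :
    H = H' := by
  apply Subtype.ext
  ext x y
  · rw [h.verts_eq, h'.verts_eq]
  · rw [h.adj_iff, h'.adj_iff]

theorem exists_copy_of_copyAlong_le {W V : Type*} {F : SimpleGraph W} {G : SimpleGraph V}
    {f : W ↪ V} (h : F.copyAlong f ≤ G) : ∃ H : GraphCopies F G, IsLabelling f H := by
  refine ⟨⟨{ verts := Set.range f, Adj := (F.copyAlong f).Adj, adj_sub := fun hxy => h hxy,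
             edge_vert := fun hxy => ?_, symm := (F.copyAlong f).symm },
           ⟨⟨Equiv.ofInjective f f.injective, fun {u v} => ?_⟩⟩⟩, rfl, fun _ _ => Iff.rfl⟩
  · obtain ⟨u, v, -, rfl, -⟩ := SimpleGraph.copyAlong_adj.1 hxy
    exact ⟨u, rfl⟩
  · change (F.copyAlong f).Adj (f u) (f v) ↔ F.Adj u v
    rw [SimpleGraph.copyAlong_adj]
    constructor
    · rintro ⟨u', v', h', hu, hv⟩
      rwa [f.injective hu, f.injective hv] at h'
    · exact fun h' => ⟨u, v, h', rfl, rfl⟩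

open Classical in
/-- The labelled analogue of a fractional decomposition, with prescribed edge totals and signed
weights: `ψ` is supported on the injections that embed `F` into `G`, and for each edge `xy` of `G`
the weights of the labelled copies containing it sum to `w x y`. -/
structure IsLabelledDecomposition {W V : Type*} [Fintype W] [Fintype V] (F : SimpleGraph W)
    (G : SimpleGraph V) (w : V → V → ℝ) (ψ : (W ↪ V) → ℝ) : Prop where
  map_le : ∀ f : W ↪ V, ψ f ≠ 0 → F.copyAlong f ≤ G
  total : ∀ x y, G.Adj x y → ∑ f : W ↪ V with (F.copyAlong f).Adj x y, ψ f = w x y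

/-! ### Weighted decompositions of a graph of fixed size -/

section Labelled

variable {W V : Type*} [Fintype W] [Fintype V] {F : SimpleGraph W} {G : SimpleGraph V}

open Classical in
/-- A fractional decomposition becomes a labelled one by moving the weight of each copy to one
chosen labelling of it. -/
theorem IsFractionalDecomposition.exists_labelled {φ : GraphCopies F G → ℝ}
    (h : IsFractionalDecomposition F G φ) :
    ∃ ψ : (W ↪ V) → ℝ, (∀ f, 0 ≤ ψ f) ∧ IsLabelledDecomposition F G (fun _ _ => 1) ψ := by
  choose emb hemb' using fun H : GraphCopies F G => exists_isLabelling H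
  have hemb : ∀ (H : GraphCopies F G) x y, (F.copyAlong (emb H)).Adj x y ↔ H.1.Adj x y :=
    fun H x y => ((hemb' H).adj_iff x y).symm
  refine ⟨fun f => ∑ H : GraphCopies F G with emb H = f, φ H,
    fun f => Finset.sum_nonneg fun H _ => h.nonneg H, fun f hf => ?_, fun x y hxy => ?_⟩
  · obtain ⟨H, hH, -⟩ := Finset.exists_ne_zero_of_sum_ne_zero hf
    obtain rfl := (Finset.mem_filter.1 hH).2
    intro x y hxy
    exact H.1.adj_sub ((hemb H x y).1 hxy)
  · rw [Finset.sum_fiberwise_eq_sum_filter, ← h.sum_eq_one s(x, y) hxy]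
    refine Finset.sum_congr ?_ fun _ _ => rfl
    ext H
    simp [hemb]

open Classical in
theorem IsLabelledDecomposition.le_one (hF : F ≠ ⊥) {ψ : (W ↪ V) → ℝ}
    (h : IsLabelledDecomposition F G (fun _ _ => 1) ψ) (h0 : ∀ f, 0 ≤ ψ f) (f : W ↪ V) :
    ψ f ≤ 1 := by
  by_cases hf : ψ f = 0
  · rw [hf]; exact zero_le_one
  obtain ⟨u, v, huv⟩ := SimpleGraph.ne_bot_iff_exists_adj.1 hF
  have hadj : (F.copyAlong f).Adj (f u) (f v) := (SimpleGraph.copyAlong_adj).2 ⟨u, v, huv, rfl, rfl⟩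
  rw [← h.total _ _ (h.map_le f hf hadj)]
  exact Finset.single_le_sum (f := ψ) (fun g _ => h0 g)
    (Finset.mem_filter.2 ⟨Finset.mem_univ f, hadj⟩)

open Classical in
theorem IsLabelledDecomposition.sum_adj_eq_zero {w : V → V → ℝ} {ψ : (W ↪ V) → ℝ}
    (h : IsLabelledDecomposition F G w ψ) {x y : V} (hxy : ¬ G.Adj x y) :
    ∑ f : W ↪ V with (F.copyAlong f).Adj x y, ψ f = 0 := by
  refine Finset.sum_eq_zero fun f hf => ?_
  by_contra hne
  exact hxy (h.map_le f hne (Finset.mem_filter.1 hf).2)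

open Classical in
/-- Every graph on `V` with all degrees at least `d` has a fractional `F`-decomposition, expressed
with labelled copies. Degrees are cardinalities of neighbour sets, so that no decidability instance
enters. -/
def DecomposesAbove (F : SimpleGraph W) (V : Type*) [Fintype V] (d : ℝ) : Prop :=
  ∀ G : SimpleGraph V, (∀ v, d ≤ ((G.neighborSet v).ncard : ℝ)) →
    ∃ ψ : (W ↪ V) → ℝ, (∀ f, 0 ≤ ψ f) ∧ IsLabelledDecomposition F G (fun _ _ => 1) ψ

open Classical in
/-- Deleting edges spanned by at most `c` vertices lowers each degree by at most `c`. -/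
theorem DecomposesAbove.sdiff {d : ℝ} (hd : DecomposesAbove F V d) {c : ℕ}
    (hG : ∀ v, d + c ≤ ((G.neighborSet v).ncard : ℝ))
    (R : SimpleGraph V) (A : Finset V) (hA : A.card ≤ c) (hR : ∀ x y, R.Adj x y → y ∈ A) :
    ∃ ψ : (W ↪ V) → ℝ, (∀ f, 0 ≤ ψ f) ∧
      IsLabelledDecomposition F (G \ R) (fun _ _ => 1) ψ := by
  refine hd _ fun v => ?_
  have hsub : G.neighborSet v ⊆ (G \ R).neighborSet v ∪ A := by
    intro y hy
    by_cases h : R.Adj v y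
    · exact Or.inr (hR _ _ h)
    · exact Or.inl ⟨hy, h⟩
  have h1 := (Set.ncard_le_ncard hsub).trans (Set.ncard_union_le _ _)
  rw [Set.ncard_coe_finset] at h1
  have h2 : ((G.neighborSet v).ncard : ℝ) ≤ ((G \ R).neighborSet v).ncard + c := by
    exact_mod_cast h1.trans (by gcongr)
  linarith [hG v]

open Classical in
/-- Any prescribed copy can be given weight at least `1`: decompose the graph without its edges,
then add the copy itself. -/
theorem DecomposesAbove.exists_one_le {d : ℝ} (hd : DecomposesAbove F V d)
    (hG : ∀ v, d + Fintype.card W ≤ ((G.neighborSet v).ncard : ℝ))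
    (f : W ↪ V) :
    ∃ ψ : (W ↪ V) → ℝ, (∀ f, 0 ≤ ψ f) ∧ IsLabelledDecomposition F G (fun _ _ => 1) ψ ∧
      (F.copyAlong f ≤ G → 1 ≤ ψ f) := by
  by_cases hf : F.copyAlong f ≤ G
  · obtain ⟨ψ, h0, hψ⟩ := hd.sdiff hG (F.copyAlong f) (Finset.univ.map f) (by simp) (by
      intro x y hxy
      obtain ⟨u, v, -, -, rfl⟩ := (SimpleGraph.copyAlong_adj).1 hxy
      simp)
    refine ⟨fun g => ψ g + if g = f then 1 else 0, fun g => ?_, ⟨fun g hg => ?_, fun x y hxy => ?_⟩,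
      fun _ => ?_⟩
    · have := h0 g
      dsimp only
      split_ifs <;> linarith
    · by_cases hgf : g = f
      · exact hgf ▸ hf
      · exact (hψ.map_le g (by simpa [hgf] using hg)).trans sdiff_le
    · rw [Finset.sum_add_distrib, Finset.sum_ite_eq']
      by_cases h : (F.copyAlong f).Adj x y
      · rw [hψ.sum_adj_eq_zero (by simp [h])]
        simp [h]
      · rw [hψ.total x y (by simp [hxy, h])]
        simp [h]
    · simpa using h0 f
  · obtain ⟨ψ, h0, hψ⟩ := hd G fun v => le_trans (by simp) (hG v)
    exact ⟨ψ, h0, hψ, fun h => absurd h hf⟩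

open Classical in
/-- A signed weighting whose edge total is the indicator of the single edge `ij`: the difference of
a decomposition of `G` and one of `G - ij`. If `i` and `j` are not adjacent, the prescribed total
vanishes on the edges of `G`. -/
theorem DecomposesAbove.exists_gadget {d : ℝ} (hF : F ≠ ⊥) (hd : DecomposesAbove F V d)
    (hW : 2 ≤ Fintype.card W)
    (hG : ∀ v, d + Fintype.card W ≤ ((G.neighborSet v).ncard : ℝ))
    (i j : V) :
    ∃ ψ : (W ↪ V) → ℝ, (∀ f, |ψ f| ≤ 1) ∧ IsLabelledDecomposition F G
      (fun x y => if (x = i ∧ y = j) ∨ (x = j ∧ y = i) then 1 else 0) ψ := by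
  obtain ⟨ψ₁, h₁, hψ₁⟩ := hd G fun v => le_trans (by simp) (hG v)
  obtain ⟨ψ₂, h₂, hψ₂⟩ := hd.sdiff hG (SimpleGraph.edge i j) {i, j}
    (Finset.card_le_two.trans hW) (by
      intro x y hxy
      simp only [SimpleGraph.edge_adj] at hxy
      simp only [Finset.mem_insert, Finset.mem_singleton]
      tauto)
  refine ⟨fun f => ψ₁ f - ψ₂ f, fun f => ?_, ⟨fun f hf => ?_, fun x y hxy => ?_⟩⟩
  · rw [abs_le]
    constructor <;>
      linarith [h₁ f, h₂ f, hψ₁.le_one hF h₁ f, hψ₂.le_one hF h₂ f]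
  · by_cases h : ψ₁ f = 0
    · exact (hψ₂.map_le f (by intro h'; simp [h, h'] at hf)).trans sdiff_le
    · exact hψ₁.map_le f h
  · rw [Finset.sum_sub_distrib, hψ₁.total x y hxy]
    have hne := hxy.ne
    by_cases h : (x = i ∧ y = j) ∨ (x = j ∧ y = i)
    · rw [hψ₂.sum_adj_eq_zero, if_pos h, sub_zero]
      simp only [SimpleGraph.sdiff_adj, SimpleGraph.edge_adj]
      tauto
    · rw [hψ₂.total, if_neg h, sub_self]
      simp only [SimpleGraph.sdiff_adj, SimpleGraph.edge_adj]
      tauto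

open Classical in
/-- Edge totals close to `1` can be met with all copies weighted away from `0`: a decomposition
with all weights at least `1 / L`, where `L` is the number of injections, is corrected by one
gadget per edge. -/
theorem DecomposesAbove.exists_weighted {d : ℝ} (hF : F ≠ ⊥) (hd : DecomposesAbove F V d)
    (hW : 2 ≤ Fintype.card W) [Nonempty (W ↪ V)]
    (hG : ∀ v, d + Fintype.card W ≤ ((G.neighborSet v).ncard : ℝ))
    {w : V → V → ℝ} (hsymm : ∀ x y, w x y = w y x) {η : ℝ}
    (hw : ∀ x y, G.Adj x y → |w x y - 1| ≤ η)
    (hη : (Fintype.card V : ℝ) ^ 2 * η ≤ 1 / (Fintype.card (W ↪ V) : ℝ)) :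
    ∃ ψ : (W ↪ V) → ℝ, IsLabelledDecomposition F G w ψ ∧
      (∀ f : W ↪ V, F.copyAlong f ≤ G → 1 / (2 * (Fintype.card (W ↪ V) : ℝ)) ≤ ψ f) ∧
      ∀ f, |ψ f| ≤ 2 := by
  set L : ℝ := (Fintype.card (W ↪ V) : ℝ) with hL
  have hL1 : 1 ≤ L := by
    rw [hL]; exact_mod_cast Fintype.card_pos
  have hL0 : 0 < L := by linarith
  choose α hα0 hα hα1 using fun f => hd.exists_one_le hG f
  choose β hβ1 hβ using fun p : V × V => hd.exists_gadget hF hW hG p.1 p.2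
  set E : Finset (V × V) := Finset.univ.filter fun p => G.Adj p.1 p.2 with hE
  have hEmem : ∀ p, p ∈ E ↔ G.Adj p.1 p.2 := fun p => by simp [hE]
  set avg : (W ↪ V) → ℝ := fun f => (∑ a, α a f) / L with havg
  -- each edge occurs as two ordered pairs, hence the factor `1 / 2`
  set cor : (W ↪ V) → ℝ := fun f => ∑ p ∈ E, (w p.1 p.2 - 1) / 2 * β p f with hcor
  have havg_le : ∀ f, avg f ≤ 1 := by
    intro f
    rw [havg]
    dsimp only
    rw [div_le_one hL0, hL]
    calc ∑ a, α a f ≤ ∑ a : W ↪ V, (1 : ℝ) :=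
          Finset.sum_le_sum fun a _ => (hα a).le_one hF (hα0 a) f
      _ = _ := by simp
  have havg_nonneg : ∀ f, 0 ≤ avg f := fun f =>
    div_nonneg (Finset.sum_nonneg fun a _ => hα0 a f) hL0.le
  have havg_ge : ∀ f : W ↪ V, F.copyAlong f ≤ G → 1 / L ≤ avg f := by
    intro f hf
    refine div_le_div_of_nonneg_right ((hα1 f hf).trans ?_) hL0.le
    exact Finset.single_le_sum (f := fun a => α a f) (fun a _ => hα0 a f) (Finset.mem_univ f)
  have hcor_le : ∀ f, |cor f| ≤ 1 / (2 * L) := by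
    intro f
    calc |cor f| ≤ ∑ p ∈ E, |(w p.1 p.2 - 1) / 2 * β p f| := Finset.abs_sum_le_sum_abs _ _
      _ ≤ ∑ p ∈ E, |η| / 2 := by
        refine Finset.sum_le_sum fun p hp => ?_
        have hp' := (hEmem p).1 hp
        rw [abs_mul, abs_div, abs_two]
        have h1 := hw _ _ hp'
        have h2 := hβ1 p f
        have h3 : |w p.1 p.2 - 1| / 2 ≤ |η| / 2 := by linarith [le_abs_self η]
        calc |w p.1 p.2 - 1| / 2 * |β p f| ≤ |η| / 2 * 1 := by gcongr
          _ = _ := mul_one _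
      _ = E.card * (|η| / 2) := by simp
      _ ≤ 1 / (2 * L) := by
        rcases E.eq_empty_or_nonempty with h0 | ⟨p, hp⟩
        · rw [h0]; simp; positivity
        · have hη0 : 0 ≤ η := (abs_nonneg _).trans (hw _ _ ((hEmem p).1 hp))
          rw [abs_of_nonneg hη0]
          have hcard : (E.card : ℝ) ≤ (Fintype.card V : ℝ) ^ 2 := by
            have := Finset.card_le_univ E
            rw [Fintype.card_prod] at this
            rw [sq]; exact_mod_cast this
          calc (E.card : ℝ) * (η / 2) ≤ (Fintype.card V : ℝ) ^ 2 * (η / 2) := by gcongr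
            _ = ((Fintype.card V : ℝ) ^ 2 * η) / 2 := by ring
            _ ≤ (1 / L) / 2 := by gcongr
            _ = _ := by field_simp
  have hhalf : 1 / (2 * L) = (1 / L) / 2 := by field_simp
  have hL1' : 1 / L ≤ 1 := by rw [div_le_one hL0]; exact hL1
  refine ⟨fun f => avg f + cor f, ⟨fun f hf => ?_, fun x y hxy => ?_⟩, fun f hf => ?_, fun f => ?_⟩
  · by_contra hn
    apply hf
    have h1 : avg f = 0 := by
      have : ∑ a, α a f = 0 := Finset.sum_eq_zero fun a _ => by
        by_contra h; exact hn ((hα a).map_le f h)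
      simp [havg, this]
    have h2 : cor f = 0 := Finset.sum_eq_zero fun p hp => by
      have : β p f = 0 := by
        by_contra h; exact hn ((hβ p).map_le f h)
      simp [this]
    simp [h1, h2]
  · rw [Finset.sum_add_distrib]
    have h1 : ∑ f : W ↪ V with (F.copyAlong f).Adj x y, avg f = 1 := by
      rw [havg, ← Finset.sum_div, Finset.sum_comm,
        Finset.sum_congr rfl fun a _ => (hα a).total x y hxy]
      simp only [Finset.sum_const, nsmul_eq_mul, mul_one, Finset.card_univ]
      exact div_self hL0.ne'
    have h2 : ∑ f : W ↪ V with (F.copyAlong f).Adj x y, cor f = w x y - 1 := by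
      rw [hcor, Finset.sum_comm]
      simp_rw [← Finset.mul_sum]
      rw [Finset.sum_congr rfl fun p hp => by rw [(hβ p).total x y hxy]]
      have hpair : E.filter (fun p : V × V => (x = p.1 ∧ y = p.2) ∨ (x = p.2 ∧ y = p.1)) =
          {(x, y), (y, x)} := by
        ext ⟨a, b⟩
        simp only [Finset.mem_filter, hEmem, Finset.mem_insert, Finset.mem_singleton, Prod.mk.injEq]
        constructor
        · rintro ⟨-, ⟨rfl, rfl⟩ | ⟨rfl, rfl⟩⟩ <;> simp
        · rintro (⟨rfl, rfl⟩ | ⟨rfl, rfl⟩)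
          · exact ⟨hxy, Or.inl ⟨rfl, rfl⟩⟩
          · exact ⟨hxy.symm, Or.inr ⟨rfl, rfl⟩⟩
      simp_rw [mul_ite, mul_one, mul_zero]
      rw [← Finset.sum_filter, hpair, Finset.sum_pair (by simp [hxy.ne])]
      dsimp only
      rw [hsymm y x]; ring
    rw [h1, h2]; ring
  · have h1 := havg_ge f hf
    have h2 := (abs_le.1 (hcor_le f)).1
    rw [hhalf] at *
    linarith
  · have h1 := havg_le f
    have h0 := havg_nonneg f
    have h2 := abs_le.1 (hcor_le f)
    rw [hhalf] at h2
    rw [abs_le]; constructor <;> linarith [h2.1, h2.2]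

end Labelled

/-! ### Counting sparse or non-injective samples -/

section Counting

variable {ι V : Type*} [Fintype ι] [Fintype V]

open Classical in
/-- The maps `g : ι → V` that agree with `a` on the coordinates in `A`. -/
noncomputable def extensions (A : Finset ι) (a : ι → V) : Finset (ι → V) :=
  Finset.univ.filter fun g => ∀ i ∈ A, g i = a i

open Classical in
theorem mem_extensions {A : Finset ι} {a g : ι → V} :
    g ∈ extensions A a ↔ ∀ i ∈ A, g i = a i := by
  simp [extensions]

open Classical in
theorem card_extensions (A : Finset ι) (a : ι → V) :
    (extensions A a).card = Fintype.card V ^ (Fintype.card ι - A.card) := by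
  have h : extensions A a =
      Fintype.piFinset fun i => if i ∈ A then {a i} else (Finset.univ : Finset V) := by
    ext g
    rw [mem_extensions, Fintype.mem_piFinset]
    refine forall_congr' fun i => ?_
    by_cases hi : i ∈ A <;> simp [hi]
  rw [h, Fintype.card_piFinset]
  simp only [apply_ite Finset.card, Finset.card_singleton, Finset.card_univ]
  rw [Finset.prod_ite, Finset.prod_const_one, one_mul, Finset.prod_const]
  congr 1
  rw [← Finset.card_compl]
  congr 1
  ext i; simp

open Classical in
/-- Overwriting the coordinate `j`, which a collision `g i = g j` makes redundant, is injective,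
and it lands in the maps with one more prescribed coordinate. -/
theorem card_extensions_collision_le {A : Finset ι} {a : ι → V} {i j : ι} (hij : i ≠ j)
    (hj : j ∉ A) :
    ((extensions A a).filter fun g => g i = g j).card * Fintype.card V ≤
      Fintype.card V ^ (Fintype.card ι - A.card) := by
  rcases isEmpty_or_nonempty V with hV | ⟨⟨v⟩⟩
  · simp
  have hcard : ((extensions A a).filter fun g => g i = g j).card ≤
      (extensions (insert j A) (Function.update a j v)).card := by
    refine Finset.card_le_card_of_injOn (fun g => Function.update g j v) (fun g hg => ?_) ?_
    · rw [Finset.mem_coe, Finset.mem_filter, mem_extensions] at hg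
      rw [Finset.mem_coe, mem_extensions]
      intro l hl
      by_cases hlj : l = j
      · subst hlj; simp
      · have := hg.1 l ((Finset.mem_insert.1 hl).resolve_left hlj)
        simp [hlj, this]
    · intro g hg g' hg' h
      rw [Finset.mem_coe, Finset.mem_filter] at hg hg'
      have hne : ∀ l, l ≠ j → g l = g' l := fun l hl => by
        have := congrFun h l
        simpa [hl] using this
      ext l
      by_cases hlj : l = j
      · subst hlj; rw [← hg.2, ← hg'.2, hne i hij]
      · exact hne l hlj
  rw [card_extensions, Finset.card_insert_of_notMem hj] at hcard
  have hlt : A.card < Fintype.card ι := Finset.card_lt_univ_of_notMem hj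
  calc _ ≤ Fintype.card V ^ (Fintype.card ι - (A.card + 1)) * Fintype.card V := by gcongr
    _ = _ := by rw [← pow_succ]; congr 1; omega

open Classical in
theorem card_extensions_not_injective_le {A : Finset ι} {a : ι → V} (ha : Set.InjOn a A) :
    (((extensions A a).filter fun g => ¬ Function.Injective g).card : ℝ) * Fintype.card V ≤
      Fintype.card ι ^ 2 * (Fintype.card V : ℝ) ^ (Fintype.card ι - A.card) := by
  have hsub : ((extensions A a).filter fun g => ¬ Function.Injective g) ⊆
      (Finset.univ.filter fun p : ι × ι => p.1 ≠ p.2 ∧ p.2 ∉ A).biUnion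
        fun p => (extensions A a).filter fun g => g p.1 = g p.2 := by
    intro g hg
    obtain ⟨hgA, hg⟩ := Finset.mem_filter.1 hg
    rw [Function.not_injective_iff] at hg
    obtain ⟨i, j, hgij, hij⟩ := hg
    simp only [Finset.mem_biUnion, Finset.mem_filter, Finset.mem_univ, true_and, Prod.exists]
    -- since `a` is injective on `A`, one end of a colliding pair lies outside `A`
    by_cases hj : j ∈ A
    · refine ⟨j, i, ⟨hij.symm, fun hi => hij ?_⟩, hgA, hgij.symm⟩
      rw [mem_extensions] at hgA
      exact ha hi hj (by rw [← hgA i hi, ← hgA j hj, hgij])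
    · exact ⟨i, j, ⟨hij, hj⟩, hgA, hgij⟩
  have h1 : ((extensions A a).filter fun g => ¬ Function.Injective g).card * Fintype.card V ≤
      Fintype.card ι ^ 2 * Fintype.card V ^ (Fintype.card ι - A.card) := by
    calc _ ≤ (∑ p : ι × ι with p.1 ≠ p.2 ∧ p.2 ∉ A,
          ((extensions A a).filter fun g => g p.1 = g p.2).card) * Fintype.card V := by
          gcongr; exact (Finset.card_le_card hsub).trans Finset.card_biUnion_le
      _ = ∑ p : ι × ι with p.1 ≠ p.2 ∧ p.2 ∉ A,
          ((extensions A a).filter fun g => g p.1 = g p.2).card * Fintype.card V :=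
          Finset.sum_mul _ _ _
      _ ≤ ∑ p : ι × ι with p.1 ≠ p.2 ∧ p.2 ∉ A,
          Fintype.card V ^ (Fintype.card ι - A.card) := by
          refine Finset.sum_le_sum fun p hp => ?_
          have hp' := (Finset.mem_filter.1 hp).2
          exact card_extensions_collision_le hp'.1 hp'.2
      _ ≤ ∑ p : ι × ι, Fintype.card V ^ (Fintype.card ι - A.card) :=
          Finset.sum_le_sum_of_subset (Finset.filter_subset _ _)
      _ = _ := by simp [sq]
  exact_mod_cast h1

open Classical in
/-- A Chernoff bound by counting. Once the value `v = g i` is fixed, the exponential moment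
`∑ g, exp (-s * deg)` factors over the coordinates, and each free coordinate contributes at most
`|V| * ρ`. -/
theorem card_extensions_low_degree_le (G : SimpleGraph V) (A : Finset ι) (a : ι → V) (i : ι)
    {s t ρ : ℝ} (hs : 0 ≤ s) (hρ0 : 0 ≤ ρ) (hρ1 : ρ ≤ 1)
    (hG : ∀ v, ∑ x, Real.exp (-s * if G.Adj v x then 1 else 0) ≤ Fintype.card V * ρ) :
    (((extensions A a).filter fun g =>
        ((Finset.univ.filter fun j => G.Adj (g i) (g j)).card : ℝ) < t).card : ℝ) ≤
      (Fintype.card V : ℝ) ^ (Fintype.card ι - A.card) *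
        (Real.exp (s * t) * ρ ^ (Fintype.card ι - A.card - 1)) := by
  set n : ℝ := (Fintype.card V : ℝ) with hn
  have hn0 : 0 ≤ n := Nat.cast_nonneg _
  -- the factor of the exponential moment at the coordinate `j`, once `g i = v` is prescribed
  set h : V → ι → V → ℝ := fun v j x =>
    (if j ∈ A then (if x = a j then 1 else 0) else 1) *
      (if j = i then (if x = v then 1 else 0) else 1) *
      Real.exp (-s * if G.Adj v x then 1 else 0) with hh
  have hh0 : ∀ v j x, 0 ≤ h v j x := fun v j x => by
    simp only [hh]; positivity
  have hpt : ∀ g : ι → V, (if g ∈ (extensions A a).filter (fun g =>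
        ((Finset.univ.filter fun j => G.Adj (g i) (g j)).card : ℝ) < t) then (1 : ℝ) else 0) ≤
      Real.exp (s * t) * ∑ v, ∏ j, h v j (g j) := by
    intro g
    split_ifs with hg
    · rw [Finset.mem_filter, mem_extensions] at hg
      have hprod : ∏ j, h (g i) j (g j) =
          Real.exp (-s * (Finset.univ.filter fun j => G.Adj (g i) (g j)).card) := by
        have : ∀ j, h (g i) j (g j) = Real.exp (-s * if G.Adj (g i) (g j) then 1 else 0) := by
          intro j
          simp only [hh]
          have h1 : (if j ∈ A then (if g j = a j then (1 : ℝ) else 0) else 1) = 1 := by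
            split_ifs with h1 h2 <;> first | rfl | exact absurd (hg.1 j h1) h2
          have h2 : (if j = i then (if g j = g i then (1 : ℝ) else 0) else 1) = 1 := by
            split_ifs with h1 h2 <;> first | rfl | exact absurd (congrArg g h1) h2
          rw [h1, h2, one_mul, one_mul]
        simp_rw [this]
        rw [← Real.exp_sum, ← Finset.mul_sum, Finset.sum_boole]
      have hle : Real.exp (s * t) * ∏ j, h (g i) j (g j) ≤
          Real.exp (s * t) * ∑ v, ∏ j, h v j (g j) := by
        gcongr
        exact Finset.single_le_sum (f := fun v => ∏ j, h v j (g j))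
          (fun v _ => Finset.prod_nonneg fun j _ => hh0 v j _) (Finset.mem_univ (g i))
      refine le_trans ?_ hle
      rw [hprod, ← Real.exp_add, Real.one_le_exp_iff]
      nlinarith [hg.2]
    · exact mul_nonneg (Real.exp_nonneg _)
        (Finset.sum_nonneg fun v _ => Finset.prod_nonneg fun j _ => hh0 v j _)
  -- for fixed `v` the sum over all maps of a product over coordinates is a product of sums
  have hswap : ∑ g : ι → V, ∑ v, ∏ j, h v j (g j) = ∑ v, ∏ j, ∑ x, h v j x := by
    rw [Finset.sum_comm]
    refine Finset.sum_congr rfl fun v _ => ?_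
    rw [Finset.prod_univ_sum, Fintype.piFinset_univ]
  have hexp1 : ∀ v x, Real.exp (-s * if G.Adj v x then 1 else 0) ≤ 1 := fun v x => by
    rw [Real.exp_le_one_iff]; split_ifs <;> linarith
  have hfac : ∀ v j, j ≠ i → ∑ x, h v j x ≤ if j ∈ A then 1 else n * ρ := by
    intro v j hj
    simp only [hh, hj, if_false, mul_one]
    split_ifs with hjA
    · simp only [ite_mul, one_mul, zero_mul, Finset.sum_ite_eq', Finset.mem_univ, if_true]
      exact hexp1 _ _
    · simpa using hG v
  have hfi : ∀ v, ∑ x, h v i x = if i ∈ A then (if v = a i then 1 else 0) else 1 := by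
    intro v
    simp [hh]
  have hrest : ∏ j ∈ Finset.univ.erase i, (if j ∈ A then 1 else n * ρ) =
      (n * ρ) ^ (Fintype.card ι - (insert i A).card) := by
    rw [Finset.prod_ite, Finset.prod_const_one, one_mul, Finset.prod_const]
    congr 1
    rw [← Finset.card_compl]
    congr 1
    ext j; simp
  have hmain : ∑ v, ∏ j, ∑ x, h v j x ≤
      (n * ρ) ^ (Fintype.card ι - (insert i A).card) * if i ∈ A then 1 else n := by
    calc ∑ v, ∏ j, ∑ x, h v j x
        ≤ ∑ v, (n * ρ) ^ (Fintype.card ι - (insert i A).card) *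
            (if i ∈ A then (if v = a i then 1 else 0) else 1) := by
          refine Finset.sum_le_sum fun v _ => ?_
          rw [← Finset.mul_prod_erase _ _ (Finset.mem_univ i), hfi, mul_comm, ← hrest]
          have h0 : (0 : ℝ) ≤ if i ∈ A then (if v = a i then 1 else 0) else 1 := by
            split_ifs <;> norm_num
          exact mul_le_mul_of_nonneg_right (Finset.prod_le_prod
            (fun j _ => Finset.sum_nonneg fun x _ => hh0 v j x)
            fun j hj => hfac v j (Finset.ne_of_mem_erase hj)) h0
      _ = _ := by
          rw [← Finset.mul_sum]
          congr 1
          split_ifs <;> simp [hn]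
  have hfinal : (n * ρ) ^ (Fintype.card ι - (insert i A).card) * (if i ∈ A then 1 else n) ≤
      n ^ (Fintype.card ι - A.card) * ρ ^ (Fintype.card ι - A.card - 1) := by
    by_cases hi : i ∈ A
    · rw [Finset.insert_eq_of_mem hi, if_pos hi, mul_one, mul_pow]
      gcongr ?_ * ?_
      exact pow_le_pow_of_le_one hρ0 hρ1 (Nat.sub_le _ _)
    · have hlt : A.card < Fintype.card ι := Finset.card_lt_univ_of_notMem hi
      rw [Finset.card_insert_of_notMem hi, if_neg hi, mul_pow, ← Nat.sub_sub, mul_right_comm,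
        ← pow_succ, Nat.sub_add_cancel (by omega)]
  calc _ = ∑ g : ι → V, (if g ∈ (extensions A a).filter (fun g =>
        ((Finset.univ.filter fun j => G.Adj (g i) (g j)).card : ℝ) < t) then (1 : ℝ) else 0) := by
        rw [Finset.sum_boole, Finset.filter_mem_eq_inter, Finset.univ_inter]
    _ ≤ ∑ g : ι → V, Real.exp (s * t) * ∑ v, ∏ j, h v j (g j) :=
        Finset.sum_le_sum fun g _ => hpt g
    _ = Real.exp (s * t) * ∑ v, ∏ j, ∑ x, h v j x := by rw [← Finset.mul_sum, hswap]
    _ ≤ Real.exp (s * t) *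
        (n ^ (Fintype.card ι - A.card) * ρ ^ (Fintype.card ι - A.card - 1)) := by
        gcongr; exact hmain.trans hfinal
    _ = _ := by ring

theorem sum_exp_adj_le (G : SimpleGraph V) [DecidableRel G.Adj] {s p : ℝ} (hs : 0 ≤ s)
    {v : V} (hG : p * Fintype.card V ≤ (G.neighborSet v).ncard) :
    ∑ x, Real.exp (-s * if G.Adj v x then 1 else 0) ≤
      Fintype.card V * Real.exp (-(p * (1 - Real.exp (-s)))) := by
  have h1 : ∀ x, Real.exp (-s * if G.Adj v x then 1 else 0) =
      1 - (1 - Real.exp (-s)) * if G.Adj v x then 1 else 0 := fun x => by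
    split_ifs <;> simp
  have hq : 0 ≤ 1 - Real.exp (-s) := by
    have : Real.exp (-s) ≤ 1 := by rw [Real.exp_le_one_iff]; linarith
    linarith
  have h2 : ((G.neighborSet v).ncard : ℝ) = ((Finset.univ.filter (G.Adj v)).card : ℝ) := by
    rw [← Set.ncard_coe_finset]; congr 2; ext; simp
  simp_rw [h1]
  rw [Finset.sum_sub_distrib, ← Finset.mul_sum, Finset.sum_boole, ← h2]
  have h3 : -(p * (1 - Real.exp (-s))) + 1 ≤ Real.exp (-(p * (1 - Real.exp (-s)))) :=
    Real.add_one_le_exp _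
  have h4 : (0 : ℝ) ≤ Fintype.card V := Nat.cast_nonneg _
  have h5 := mul_le_mul_of_nonneg_left hG hq
  have h6 := mul_le_mul_of_nonneg_left h3 h4
  simp only [Finset.sum_const, Finset.card_univ, nsmul_eq_mul, mul_one]
  linarith

/-- The Chernoff bound with `s = ε / 4`, for the threshold `(p - ε / 2) * m`. The inequality
`1 - exp (-s) ≥ s - s ^ 2` gives the exponent `-s * (ε / 2 - s) * m = -ε ^ 2 / 16 * m`; the at most
`k + 1` coordinates that are not free cost the factor `exp (k + 1)`. -/
theorem exp_mul_pow_le {ε p : ℝ} (hε : 0 ≤ ε) (hp0 : 0 ≤ p) (hp1 : p ≤ 1) (m l k : ℕ)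
    (hl : l ≤ k) :
    Real.exp (ε / 4 * ((p - ε / 2) * m)) *
        Real.exp (-(p * (1 - Real.exp (-(ε / 4))))) ^ (m - l - 1) ≤
      Real.exp (k + 1 - ε ^ 2 / 16 * m) := by
  rw [← Real.exp_nat_mul, ← Real.exp_add, Real.exp_le_exp]
  set s : ℝ := ε / 4 with hs
  set q : ℝ := 1 - Real.exp (-s) with hq
  have hs0 : 0 ≤ s := by rw [hs]; linarith
  have hq1 : q ≤ 1 := by linarith [Real.exp_pos (-s)]
  have hqs : s - s ^ 2 ≤ q := by
    have h1 := Real.add_one_le_exp s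
    have h2 : Real.exp (-s) * Real.exp s = 1 := by rw [← Real.exp_add]; simp
    have h3 := Real.exp_pos (-s)
    have h4 : Real.exp (-s) * (s + 1) ≤ 1 := by nlinarith
    have h5 : Real.exp (-s) * (s + 1) ≤ (1 - s + s ^ 2) * (s + 1) := by nlinarith [pow_nonneg hs0 3]
    have := le_of_mul_le_mul_right h5 (by linarith)
    linarith
  have hq0 : 0 ≤ q := by
    have : Real.exp (-s) ≤ 1 := by rw [Real.exp_le_one_iff]; linarith
    linarith
  have hm : (m : ℝ) - (k + 1) ≤ ((m - l - 1 : ℕ) : ℝ) := by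
    have : m ≤ (m - l - 1) + (k + 1) := by omega
    have : (m : ℝ) ≤ ((m - l - 1 : ℕ) : ℝ) + (k + 1) := by exact_mod_cast this
    linarith
  have hpq0 : 0 ≤ p * q := mul_nonneg hp0 hq0
  have hpq1 : p * q ≤ 1 := mul_le_one₀ hp1 hq0 hq1
  have hk : p * q * (k + 1) ≤ 1 * (k + 1) := by gcongr
  have h1 := mul_le_mul_of_nonneg_left hm hpq0
  have h2 : p * (s - s ^ 2) ≤ p * q := by gcongr
  have h3 : p * s ^ 2 ≤ s ^ 2 := by nlinarith [sq_nonneg s]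
  have h4 : s * (p - ε / 2) - p * q ≤ -(ε ^ 2 / 16) := by
    have : ε = 4 * s := by rw [hs]; ring
    rw [this]; nlinarith
  have h5 := mul_le_mul_of_nonneg_right h4 (Nat.cast_nonneg (α := ℝ) m)
  nlinarith

open Classical in
/-- The injections `g : ι ↪ V` for which the sampled graph `G.comap g` has all degrees at least
`t`. -/
noncomputable def goodEmbeddings (ι : Type*) [Fintype ι] (G : SimpleGraph V) (t : ℝ) :
    Finset (ι ↪ V) :=
  Finset.univ.filter fun g => ∀ i, t ≤ (((G.comap g).neighborSet i).ncard : ℝ)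

open Classical in
theorem mem_goodEmbeddings {G : SimpleGraph V} {t : ℝ} {g : ι ↪ V} :
    g ∈ goodEmbeddings ι G t ↔ ∀ i, t ≤ (((G.comap g).neighborSet i).ncard : ℝ) := by
  simp [goodEmbeddings]

open Classical in
theorem card_embeddings_extending_le (A : Finset ι) (a : ι → V) :
    ((Finset.univ.filter fun g : ι ↪ V => ∀ i ∈ A, g i = a i).card : ℝ) ≤
      (Fintype.card V : ℝ) ^ (Fintype.card ι - A.card) := by
  have : (Finset.univ.filter fun g : ι ↪ V => ∀ i ∈ A, g i = a i).card ≤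
      (extensions A a).card := by
    refine Finset.card_le_card_of_injOn (fun g => g) (fun g hg => ?_)
      (DFunLike.coe_injective.injOn)
    simpa [mem_extensions] using hg
  rw [card_extensions] at this
  exact_mod_cast this

open Classical in
/-- Almost all maps with prescribed values on a small set `A` are injective and induce a sample of
large minimum degree. -/
theorem card_goodEmbeddings_extending_ge (G : SimpleGraph V) [Nonempty V] {ε p : ℝ} (hε : 0 ≤ ε)
    (hp0 : 0 ≤ p) (hp1 : p ≤ 1) (hG : ∀ v, p * Fintype.card V ≤ ((G.neighborSet v).ncard : ℝ))
    {A : Finset ι} {a : ι → V} (ha : Set.InjOn a A) {k : ℕ} (hA : A.card ≤ k) :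
    (1 - ((Fintype.card ι : ℝ) ^ 2 / Fintype.card V +
        Fintype.card ι * Real.exp (k + 1 - ε ^ 2 / 16 * Fintype.card ι))) *
      (Fintype.card V : ℝ) ^ (Fintype.card ι - A.card) ≤
    (((goodEmbeddings ι G ((p - ε / 2) * Fintype.card ι)).filter
      fun g => ∀ i ∈ A, g i = a i).card : ℝ) := by
  set m := Fintype.card ι with hm
  set n := Fintype.card V with hn
  have hn0 : (0 : ℝ) < n := by exact_mod_cast Fintype.card_pos
  set t : ℝ := (p - ε / 2) * m with ht
  set N : ℝ := (n : ℝ) ^ (m - A.card) with hN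
  set good := (goodEmbeddings ι G t).filter fun g => ∀ i ∈ A, g i = a i with hgood
  set inj := (extensions A a).filter fun g => ¬ Function.Injective g
  set low : ι → Finset (ι → V) := fun i => (extensions A a).filter fun g =>
    ((Finset.univ.filter fun j => G.Adj (g i) (g j)).card : ℝ) < t
  have hcover : extensions A a ⊆ good.image (fun g : ι ↪ V => ⇑g) ∪
      (inj ∪ Finset.univ.biUnion low) := by
    intro g hg
    by_contra hcon
    simp only [Finset.mem_union, not_or, Finset.mem_biUnion, Finset.mem_univ, true_and, not_exists,
      inj, low, Finset.mem_filter, hg, not_not, not_lt] at hcon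
    obtain ⟨h1, h2, h3⟩ := hcon
    refine h1 (Finset.mem_image.2 ⟨⟨g, h2⟩, ?_, rfl⟩)
    rw [hgood, Finset.mem_filter, mem_goodEmbeddings]
    refine ⟨fun i => (h3 i).trans_eq ?_, mem_extensions.1 hg⟩
    rw [← Set.ncard_coe_finset]; congr 2; ext; simp
  have hc1 : ((extensions A a).card : ℝ) ≤ good.card + (inj.card + ∑ i, ((low i).card : ℝ)) := by
    have h := (Finset.card_le_card hcover).trans (Finset.card_union_le _ _)
    have h' := (Finset.card_union_le inj (Finset.univ.biUnion low)).trans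
      (Nat.add_le_add_left Finset.card_biUnion_le _)
    exact_mod_cast h.trans (Nat.add_le_add Finset.card_image_le h')
  have hc2 : (inj.card : ℝ) ≤ (m : ℝ) ^ 2 / n * N := by
    rw [div_mul_eq_mul_div, le_div_iff₀ hn0]
    exact card_extensions_not_injective_le ha
  have hs : (0 : ℝ) ≤ ε / 4 := by linarith
  have hc3 : ∀ i, ((low i).card : ℝ) ≤ N * Real.exp (k + 1 - ε ^ 2 / 16 * m) := by
    intro i
    have hq : 0 ≤ 1 - Real.exp (-(ε / 4)) := by
      have : Real.exp (-(ε / 4)) ≤ 1 := by rw [Real.exp_le_one_iff]; linarith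
      linarith
    refine (card_extensions_low_degree_le G A a i hs (Real.exp_nonneg _) ?_
      fun v => sum_exp_adj_le G hs (hG v)).trans ?_
    · rw [Real.exp_le_one_iff]
      have := mul_nonneg hp0 hq
      linarith
    · gcongr
      exact exp_mul_pow_le hε hp0 hp1 m A.card k hA
  have hc4 : ∑ i, ((low i).card : ℝ) ≤ m * (N * Real.exp (k + 1 - ε ^ 2 / 16 * m)) := by
    refine (Finset.sum_le_sum fun i _ => hc3 i).trans_eq ?_
    simp [hm]
  have hcard : ((extensions A a).card : ℝ) = N := by
    rw [card_extensions, hN]; push_cast; rfl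
  rw [hcard] at hc1
  linarith

end Counting

/-! ### Averaging decompositions over samples -/

theorem SimpleGraph.copyAlong_trans_adj {W ι V : Type*} {F : SimpleGraph W} {f : W ↪ ι}
    {g : ι ↪ V} {x y : V} :
    (F.copyAlong (f.trans g)).Adj x y ↔ ∃ i j, (F.copyAlong f).Adj i j ∧ g i = x ∧ g j = y := by
  simp only [SimpleGraph.copyAlong_adj, Function.Embedding.trans_apply]
  constructor
  · rintro ⟨u, v, huv, rfl, rfl⟩
    exact ⟨_, _, ⟨u, v, huv, rfl, rfl⟩, rfl, rfl⟩
  · rintro ⟨_, _, ⟨u, v, huv, rfl, rfl⟩, rfl, rfl⟩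
    exact ⟨u, v, huv, rfl, rfl⟩

theorem SimpleGraph.copyAlong_trans_le_iff {W ι V : Type*} {F : SimpleGraph W}
    {G : SimpleGraph V} {f : W ↪ ι} {g : ι ↪ V} :
    F.copyAlong (f.trans g) ≤ G ↔ F.copyAlong f ≤ G.comap g := by
  constructor
  · intro h i j hij
    exact h (SimpleGraph.copyAlong_trans_adj.2 ⟨i, j, hij, rfl, rfl⟩)
  · intro h x y hxy
    obtain ⟨i, j, hij, rfl, rfl⟩ := SimpleGraph.copyAlong_trans_adj.1 hxy
    exact h hij

open Classical in
/-- The number of embeddings in `S` whose image contains both `x` and `y`, counted through the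
ordered pairs of coordinates that take these values. -/
noncomputable def pairCount {ι V : Type*} [Fintype ι] (S : Finset (ι ↪ V)) (x y : V) : ℕ :=
  ∑ g ∈ S, (Finset.univ.filter fun p : ι × ι => p.1 ≠ p.2 ∧ g p.1 = x ∧ g p.2 = y).card

open Classical in
theorem pairCount_comm {ι V : Type*} [Fintype ι] (S : Finset (ι ↪ V)) (x y : V) :
    pairCount S x y = pairCount S y x := by
  refine Finset.sum_congr rfl fun g _ => ?_
  refine Finset.card_equiv (Equiv.prodComm ι ι) fun p => ?_
  simp only [Finset.mem_filter, Finset.mem_univ, true_and, Equiv.prodComm_apply, Prod.fst_swap,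
    Prod.snd_swap]
  tauto

open Classical in
/-- Carrying a weighted decomposition of a sample to `V` along `g` contributes `w x y` to the edge
`xy` if both of its ends are sampled, and nothing otherwise; the cardinality on the right is `1` or
`0` accordingly. -/
theorem IsLabelledDecomposition.sum_copyAlong_trans {W ι V : Type*} [Fintype W] [Fintype ι]
    {F : SimpleGraph W} {G : SimpleGraph V} {w : V → V → ℝ} {ψ : (W ↪ ι) → ℝ} {g : ι ↪ V}
    (h : IsLabelledDecomposition F (G.comap g) (fun i j => w (g i) (g j)) ψ) {x y : V}
    (hxy : G.Adj x y) :
    ∑ f : W ↪ ι with (F.copyAlong (f.trans g)).Adj x y, ψ f =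
      ((Finset.univ.filter fun p : ι × ι => p.1 ≠ p.2 ∧ g p.1 = x ∧ g p.2 = y).card : ℝ) *
        w x y := by
  by_cases hr : ∃ i j, g i = x ∧ g j = y
  · obtain ⟨i, j, rfl, rfl⟩ := hr
    have hij : i ≠ j := fun h => hxy.ne (congrArg g h)
    have h1 : (Finset.univ.filter fun p : ι × ι => p.1 ≠ p.2 ∧ g p.1 = g i ∧ g p.2 = g j) =
        {(i, j)} := by
      ext ⟨a, b⟩
      simp only [Finset.mem_filter, Finset.mem_univ, true_and, EmbeddingLike.apply_eq_iff_eq,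
        Finset.mem_singleton, Prod.mk.injEq]
      constructor
      · exact fun h => h.2
      · rintro ⟨rfl, rfl⟩
        exact ⟨hij, rfl, rfl⟩
    rw [h1, Finset.card_singleton, Nat.cast_one, one_mul, ← h.total i j hxy]
    refine Finset.sum_congr (Finset.filter_congr fun f _ => ?_) fun _ _ => rfl
    rw [SimpleGraph.copyAlong_trans_adj]
    constructor
    · rintro ⟨i', j', hadj, hi, hj⟩
      rwa [g.injective hi, g.injective hj] at hadj
    · exact fun h => ⟨i, j, h, rfl, rfl⟩
  · have h1 : (Finset.univ.filter fun p : ι × ι => p.1 ≠ p.2 ∧ g p.1 = x ∧ g p.2 = y) = ∅ :=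
      Finset.filter_eq_empty_iff.2 fun p _ hp => hr ⟨p.1, p.2, hp.2⟩
    rw [h1, Finset.card_empty, Nat.cast_zero, zero_mul]
    refine Finset.sum_eq_zero fun f hf => absurd ?_ hr
    obtain ⟨i, j, -, hi, hj⟩ := SimpleGraph.copyAlong_trans_adj.1 (Finset.mem_filter.1 hf).2
    exact ⟨i, j, hi, hj⟩

section Averaging

variable {W ι V : Type*} [Fintype W] [Fintype ι] [Fintype V] {F : SimpleGraph W}
  {G : SimpleGraph V}

open Classical in
theorem pairCount_bounds {S : Finset (ι ↪ V)} {κ : ℝ}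
    (hS : ∀ (A : Finset ι) (a : ι → V), A.card ≤ 2 → Set.InjOn a A →
      (1 - κ) * (Fintype.card V : ℝ) ^ (Fintype.card ι - A.card) ≤
        ((S.filter fun g => ∀ i ∈ A, g i = a i).card : ℝ)) {x y : V} (hxy : x ≠ y) :
    (1 - κ) * ((Fintype.card ι * (Fintype.card ι - 1) : ℕ) *
        (Fintype.card V : ℝ) ^ (Fintype.card ι - 2)) ≤ pairCount S x y ∧
      (pairCount S x y : ℝ) ≤ (Fintype.card ι * (Fintype.card ι - 1) : ℕ) *
        (Fintype.card V : ℝ) ^ (Fintype.card ι - 2) := by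
  have h1 : pairCount S x y = ∑ p ∈ (Finset.univ : Finset ι).offDiag,
      (S.filter fun g => g p.1 = x ∧ g p.2 = y).card := by
    rw [pairCount]
    simp only [Finset.card_filter]
    rw [Finset.sum_comm]
    rw [← Finset.sum_subset (Finset.subset_univ (Finset.univ : Finset ι).offDiag)]
    · refine Finset.sum_congr rfl fun p hp => Finset.sum_congr rfl fun g _ => ?_
      have : p.1 ≠ p.2 := (Finset.mem_offDiag.1 hp).2.2
      simp [this]
    · intro p _ hp
      have : p.1 = p.2 := by simpa using hp
      simp [this]
  have hoff : ((Finset.univ : Finset ι).offDiag.card : ℝ) =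
      (Fintype.card ι * (Fintype.card ι - 1) : ℕ) := by
    rw [Finset.offDiag_card, Finset.card_univ, Nat.mul_sub_one]
  have hterm : ∀ p ∈ (Finset.univ : Finset ι).offDiag,
      (1 - κ) * (Fintype.card V : ℝ) ^ (Fintype.card ι - 2) ≤
        ((S.filter fun g => g p.1 = x ∧ g p.2 = y).card : ℝ) ∧
      ((S.filter fun g => g p.1 = x ∧ g p.2 = y).card : ℝ) ≤
        (Fintype.card V : ℝ) ^ (Fintype.card ι - 2) := by
    rintro ⟨i, j⟩ hp
    have hij : i ≠ j := (Finset.mem_offDiag.1 hp).2.2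
    have hA : ({i, j} : Finset ι).card = 2 := Finset.card_pair hij
    set a : ι → V := fun l => if l = i then x else y with ha
    have hai : a i = x := by simp [ha]
    have haj : a j = y := by simp [ha, hij.symm]
    have hiff : ∀ g : ι ↪ V, (∀ l ∈ ({i, j} : Finset ι), g l = a l) ↔ g i = x ∧ g j = y := by
      intro g
      simp [hai, haj]
    have hinj : Set.InjOn a ({i, j} : Finset ι) := by
      intro l hl l' hl' h
      simp only [Finset.coe_insert, Finset.coe_singleton, Set.mem_insert_iff,
        Set.mem_singleton_iff] at hl hl'
      rcases hl with rfl | rfl <;> rcases hl' with rfl | rfl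
      · rfl
      · rw [hai, haj] at h; exact absurd h hxy
      · rw [hai, haj] at h; exact absurd h.symm hxy
      · rfl
    constructor
    · have := hS {i, j} a hA.le hinj
      simpa only [hA, hiff] using this
    · have := card_embeddings_extending_le ({i, j} : Finset ι) a
      simp only [hA, hiff] at this
      refine le_trans ?_ this
      exact_mod_cast Finset.card_le_card (Finset.filter_subset_filter _ (Finset.subset_univ S))
  rw [h1]
  push_cast [← hoff]
  constructor
  · calc _ = ∑ p ∈ (Finset.univ : Finset ι).offDiag,
          (1 - κ) * (Fintype.card V : ℝ) ^ (Fintype.card ι - 2) := by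
          rw [Finset.sum_const, nsmul_eq_mul, hoff]; push_cast; ring
      _ ≤ _ := Finset.sum_le_sum fun p hp => (hterm p hp).1
  · calc _ ≤ ∑ p ∈ (Finset.univ : Finset ι).offDiag,
          (Fintype.card V : ℝ) ^ (Fintype.card ι - 2) :=
          Finset.sum_le_sum fun p hp => (hterm p hp).2
      _ = _ := by rw [Finset.sum_const, nsmul_eq_mul, hoff]

open Classical in
/-- If the family `S` of samples covers all small vertex tuples almost evenly, and the samples in
`S` admit weighted decompositions with weights in `[c, 2]`, then averaging over `S` decomposes `G`
exactly, with all weights of the same order. -/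
theorem exists_labelledDecomposition_of_sample [Nonempty V] [Nonempty (W ↪ ι)]
    (hW : 2 ≤ Fintype.card W) {S : Finset (ι ↪ V)} {κ c : ℝ} (hκ : κ ≤ 1 / 2)
    (hc : 0 ≤ c)
    (hS : ∀ (A : Finset ι) (a : ι → V), A.card ≤ Fintype.card W → Set.InjOn a A →
      (1 - κ) * (Fintype.card V : ℝ) ^ (Fintype.card ι - A.card) ≤
        ((S.filter fun g => ∀ i ∈ A, g i = a i).card : ℝ))
    (hdec : ∀ g ∈ S, ∀ w : ι → ι → ℝ, (∀ i j, w i j = w j i) →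
      (∀ i j, (G.comap g).Adj i j → |w i j - 1| ≤ 2 * κ) →
      ∃ ψ : (W ↪ ι) → ℝ, IsLabelledDecomposition F (G.comap g) w ψ ∧
        (∀ f : W ↪ ι, F.copyAlong f ≤ G.comap g → c ≤ ψ f) ∧ ∀ f, |ψ f| ≤ 2) :
    ∃ Ψ : (W ↪ V) → ℝ, IsLabelledDecomposition F G (fun _ _ => 1) Ψ ∧ ∀ h : W ↪ V, 0 ≤ Ψ h ∧
      (F.copyAlong h ≤ G → c * ((1 - κ) *
          (Fintype.card V : ℝ) ^ (Fintype.card ι - Fintype.card W)) /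
        ((Fintype.card ι * (Fintype.card ι - 1) : ℕ) *
          (Fintype.card V : ℝ) ^ (Fintype.card ι - 2)) ≤ Ψ h) ∧
      Ψ h ≤ (Fintype.card (W ↪ ι) : ℝ) *
          ((Fintype.card V : ℝ) ^ (Fintype.card ι - Fintype.card W) * 2) /
        ((Fintype.card ι * (Fintype.card ι - 1) : ℕ) *
          (Fintype.card V : ℝ) ^ (Fintype.card ι - 2)) := by
  obtain ⟨f₀⟩ := ‹Nonempty (W ↪ ι)›
  have hWι : Fintype.card W ≤ Fintype.card ι := Fintype.card_le_of_embedding f₀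
  have hn : (0 : ℝ) < Fintype.card V := by exact_mod_cast Fintype.card_pos
  set N₀ : ℝ := (Fintype.card ι * (Fintype.card ι - 1) : ℕ) *
    (Fintype.card V : ℝ) ^ (Fintype.card ι - 2) with hN₀
  have hN₀pos : 0 < N₀ := by
    have : 0 < Fintype.card ι * (Fintype.card ι - 1) := Nat.mul_pos (by omega) (by omega)
    have : (0 : ℝ) < (Fintype.card ι * (Fintype.card ι - 1) : ℕ) := by exact_mod_cast this
    positivity
  have hN : ∀ {x y : V}, x ≠ y →
      (1 - κ) * N₀ ≤ pairCount S x y ∧ (pairCount S x y : ℝ) ≤ N₀ := fun hxy =>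
    pairCount_bounds (fun A a hA => hS A a (hA.trans hW)) hxy
  have hNpos : ∀ {x y : V}, x ≠ y → (0 : ℝ) < pairCount S x y := fun hxy =>
    lt_of_lt_of_le (mul_pos (by linarith) hN₀pos) (hN hxy).1
  -- the weight of an edge compensates for the number of samples that contain it
  set w : V → V → ℝ := fun x y => N₀ / pairCount S x y with hw
  have hw1 : ∀ x y, x ≠ y → |w x y - 1| ≤ 2 * κ := by
    intro x y hxy
    have h0 := hNpos hxy
    obtain ⟨h1, h2⟩ := hN hxy
    have hκ0 : 0 ≤ κ := by
      by_contra! h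
      nlinarith
    have h3 : w x y - 1 = (N₀ - pairCount S x y) / pairCount S x y := by
      rw [hw]; field_simp
    rw [h3, abs_of_nonneg (div_nonneg (by linarith) h0.le), div_le_iff₀ h0]
    have h4 : N₀ ≤ 2 * pairCount S x y := by nlinarith
    nlinarith [mul_le_mul_of_nonneg_left h4 hκ0]
  have hex : ∀ g : ι ↪ V, ∃ ψ : (W ↪ ι) → ℝ, g ∈ S →
      IsLabelledDecomposition F (G.comap g) (fun i j => w (g i) (g j)) ψ ∧
        (∀ f : W ↪ ι, F.copyAlong f ≤ G.comap g → c ≤ ψ f) ∧ ∀ f, |ψ f| ≤ 2 := by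
    intro g
    by_cases hg : g ∈ S
    · obtain ⟨ψ, hψ⟩ := hdec g hg (fun i j => w (g i) (g j))
        (fun i j => by simp only [hw]; rw [pairCount_comm])
        (fun i j hij => hw1 _ _ (SimpleGraph.Adj.ne (G := G) hij))
      exact ⟨ψ, fun _ => hψ⟩
    · exact ⟨0, fun h => absurd h hg⟩
  choose ψ hψ using hex
  have hψ0 : ∀ g ∈ S, ∀ f, 0 ≤ ψ g f := by
    intro g hg f
    by_cases h : ψ g f = 0
    · exact h.ge
    · exact hc.trans ((hψ g hg).2.1 f ((hψ g hg).1.map_le f h))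
  refine ⟨fun h => (∑ f : W ↪ ι, ∑ g ∈ S with f.trans g = h, ψ g f) / N₀,
    ⟨fun h hh => ?_, fun x y hxy => ?_⟩, fun h => ⟨?_, fun hle => ?_, ?_⟩⟩
  · obtain ⟨f, -, hf⟩ := Finset.exists_ne_zero_of_sum_ne_zero (div_ne_zero_iff.1 hh).1
    obtain ⟨g, hg, hgf⟩ := Finset.exists_ne_zero_of_sum_ne_zero hf
    obtain ⟨hgS, rfl⟩ := Finset.mem_filter.1 hg
    exact SimpleGraph.copyAlong_trans_le_iff.2 ((hψ g hgS).1.map_le f hgf)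
  · rw [← Finset.sum_div, Finset.sum_comm, div_eq_one_iff_eq hN₀pos.ne']
    simp_rw [Finset.sum_fiberwise_eq_sum_filter]
    simp only [Finset.mem_filter, Finset.mem_univ, true_and]
    simp_rw [Finset.sum_filter]
    rw [Finset.sum_comm]
    simp_rw [← Finset.sum_filter]
    rw [Finset.sum_congr rfl fun g hg => (hψ g hg).1.sum_copyAlong_trans hxy, ← Finset.sum_mul,
      ← Nat.cast_sum]
    change (pairCount S x y : ℝ) * (N₀ / pairCount S x y) = N₀
    exact mul_div_cancel₀ _ (hNpos hxy.ne).ne'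
  · exact div_nonneg (Finset.sum_nonneg fun f _ => Finset.sum_nonneg fun g hg =>
      hψ0 g (Finset.mem_filter.1 hg).1 f) hN₀pos.le
  · refine div_le_div_of_nonneg_right ?_ hN₀pos.le
    obtain ⟨v₀⟩ := ‹Nonempty V›
    set a : ι → V := Function.extend f₀ h (fun _ => v₀) with ha
    have haf : ∀ u, a (f₀ u) = h u := fun u => f₀.injective.extend_apply _ _ _
    have hA : (Finset.univ.map f₀).card = Fintype.card W := by simp
    have hinj : Set.InjOn a (Finset.univ.map f₀) := by
      intro l hl l' hl' hll
      obtain ⟨u, -, rfl⟩ := Finset.mem_map.1 (Finset.mem_coe.1 hl)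
      obtain ⟨u', -, rfl⟩ := Finset.mem_map.1 (Finset.mem_coe.1 hl')
      rw [haf, haf] at hll
      rw [h.injective hll]
    have hcount := hS (Finset.univ.map f₀) a hA.le hinj
    have hiff : ∀ g : ι ↪ V, (∀ l ∈ Finset.univ.map f₀, g l = a l) ↔ f₀.trans g = h := by
      intro g
      simp [haf, DFunLike.ext_iff]
    simp only [hA, hiff] at hcount
    calc c * ((1 - κ) * (Fintype.card V : ℝ) ^ (Fintype.card ι - Fintype.card W))
        ≤ c * ((S.filter fun g => f₀.trans g = h).card : ℝ) := by gcongr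
      _ = ∑ g ∈ S with f₀.trans g = h, c := by simp [mul_comm]
      _ ≤ ∑ g ∈ S with f₀.trans g = h, ψ g f₀ := by
          refine Finset.sum_le_sum fun g hg => ?_
          obtain ⟨hgS, rfl⟩ := Finset.mem_filter.1 hg
          exact (hψ g hgS).2.1 f₀ (SimpleGraph.copyAlong_trans_le_iff.1 hle)
      _ ≤ _ := Finset.single_le_sum (f := fun f : W ↪ ι => ∑ g ∈ S with f.trans g = h, ψ g f)
          (fun f _ => Finset.sum_nonneg fun g hg => hψ0 g (Finset.mem_filter.1 hg).1 f)
          (Finset.mem_univ f₀)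
  · refine div_le_div_of_nonneg_right ?_ hN₀pos.le
    obtain ⟨v₀⟩ := ‹Nonempty V›
    calc ∑ f : W ↪ ι, ∑ g ∈ S with f.trans g = h, ψ g f
        ≤ ∑ f : W ↪ ι, (Fintype.card V : ℝ) ^ (Fintype.card ι - Fintype.card W) * 2 := by
          refine Finset.sum_le_sum fun f _ => ?_
          have hcount := card_embeddings_extending_le (Finset.univ.map f)
            (Function.extend f h (fun _ => v₀))
          have hiff : ∀ g : ι ↪ V, (∀ l ∈ Finset.univ.map f,
              g l = Function.extend f h (fun _ => v₀) l) ↔ f.trans g = h := by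
            intro g
            simp [f.injective.extend_apply, DFunLike.ext_iff]
          simp only [hiff, Finset.card_map, Finset.card_univ] at hcount
          calc ∑ g ∈ S with f.trans g = h, ψ g f ≤ ∑ g ∈ S with f.trans g = h, (2 : ℝ) :=
                Finset.sum_le_sum fun g hg => (le_abs_self _).trans
                  ((hψ g (Finset.mem_filter.1 hg).1).2.2 f)
            _ = ((S.filter fun g => f.trans g = h).card : ℝ) * 2 := by simp
            _ ≤ _ := by
                gcongr
                refine le_trans ?_ hcount
                exact_mod_cast
                  Finset.card_le_card (Finset.filter_subset_filter _ (Finset.subset_univ S))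
      _ = _ := by simp

open Classical in
/-- Summing the weights of all labellings of a copy turns a labelled decomposition into a
fractional one. A copy has at most `v(F) ^ v(F)` labellings. -/
theorem IsLabelledDecomposition.exists_fractional {Ψ : (W ↪ V) → ℝ}
    (hΨ : IsLabelledDecomposition F G (fun _ _ => 1) Ψ) (h0 : ∀ f, 0 ≤ Ψ f) {lo hi : ℝ}
    (hlo : ∀ f : W ↪ V, F.copyAlong f ≤ G → lo ≤ Ψ f) (hhi : ∀ f, Ψ f ≤ hi) :
    ∃ φ : GraphCopies F G → ℝ, IsFractionalDecomposition F G φ ∧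
      ∀ H, lo ≤ φ H ∧ φ H ≤ (Fintype.card W : ℝ) ^ Fintype.card W * hi := by
  have hadj : ∀ (H : GraphCopies F G) x y, s(x, y) ∈ H.1.edgeSet ↔ H.1.Adj x y :=
    fun H x y => SimpleGraph.Subgraph.mem_edgeSet
  refine ⟨fun H => ∑ f : W ↪ V with IsLabelling f H, Ψ f,
    ⟨fun H => Finset.sum_nonneg fun f _ => h0 f, fun e he => ?_⟩, fun H => ?_⟩
  · induction e with | h x y => ?_
    rw [← hΨ.total x y he]
    simp only [Finset.sum_filter (p := fun f : W ↪ V => IsLabelling f _)]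
    rw [Finset.sum_comm, Finset.sum_filter (p := fun f : W ↪ V => (F.copyAlong f).Adj x y)]
    refine Finset.sum_congr rfl fun f _ => ?_
    by_cases hf : Ψ f = 0
    · simp [hf]
    -- a labelled copy of nonzero weight labels exactly one copy
    · obtain ⟨H, hH⟩ := exists_copy_of_copyAlong_le (hΨ.map_le f hf)
      have hiff : ∀ H', IsLabelling f H' ↔ H' = H :=
        fun H' => ⟨fun h => h.unique hH, fun h => h ▸ hH⟩
      simp [hiff, ← hH.adj_iff]
  · obtain ⟨f₀, hf₀⟩ := exists_isLabelling H
    constructor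
    · exact (hlo f₀ hf₀.copyAlong_le).trans
        (Finset.single_le_sum (fun f _ => h0 f) (Finset.mem_filter.2 ⟨Finset.mem_univ _, hf₀⟩))
    · have hcard : (Finset.univ.filter fun f : W ↪ V => IsLabelling f H).card ≤
          Fintype.card W ^ Fintype.card W := by
        calc _ = ((Finset.univ.filter fun f : W ↪ V => IsLabelling f H).image
              fun f : W ↪ V => (⇑f : W → V)).card :=
              (Finset.card_image_of_injective _ DFunLike.coe_injective).symm
          _ ≤ (Finset.univ.image fun π : W → W => f₀ ∘ π).card := by
              refine Finset.card_le_card fun g hg => ?_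
              obtain ⟨f, hf, rfl⟩ := Finset.mem_image.1 hg
              have hf := (Finset.mem_filter.1 hf).2
              have hrange : ∀ u, ∃ u', f₀ u' = f u := fun u => by
                have : f u ∈ Set.range f₀ := by
                  rw [← hf₀.verts_eq, hf.verts_eq]; exact ⟨u, rfl⟩
                exact this
              choose π hπ using hrange
              exact Finset.mem_image.2 ⟨π, Finset.mem_univ _, funext hπ⟩
          _ ≤ (Finset.univ : Finset (W → W)).card := Finset.card_image_le
          _ = _ := by simp
      calc _ ≤ ∑ f : W ↪ V with IsLabelling f H, hi := Finset.sum_le_sum fun f _ => hhi f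
        _ = ((Finset.univ.filter fun f : W ↪ V => IsLabelling f H).card : ℝ) * hi := by simp
        _ ≤ _ := by
            have : 0 ≤ hi := (h0 f₀).trans (hhi f₀)
            gcongr
            exact_mod_cast hcard

end Averaging

/-! ### The threshold and the choice of the sample size -/

section Threshold

variable {W : Type*}

theorem SimpleGraph.ncard_neighborSet_eq_degree {V : Type*} (G : SimpleGraph V) (v : V)
    [Fintype (G.neighborSet v)] : (G.neighborSet v).ncard = G.degree v := by
  rw [← G.card_neighborFinset_eq_degree, ← Set.ncard_coe_finset, G.coe_neighborFinset]

/-- No graph on `n ≥ 1` vertices has minimum degree `n`, so that `δ = 1` satisfies the condition in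
the definition of the threshold vacuously. -/
theorem one_mem_threshold_set (F : SimpleGraph W) :
    (1 : ℝ) ∈ {δ : ℝ | δ ∈ Set.Icc (0 : ℝ) 1 ∧
      ∃ n₀ : ℕ, ∀ n : ℕ, n₀ ≤ n → ∀ (G : SimpleGraph (Fin n)) [DecidableRel G.Adj],
        δ * (n : ℝ) ≤ (G.minDegree : ℝ) →
          ∃ φ : GraphCopies F G → ℝ, IsFractionalDecomposition F G φ} := by
  refine ⟨by simp, 1, fun n hn G _ h => ?_⟩
  have : Nonempty (Fin n) := ⟨⟨0, hn⟩⟩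
  have hlt := G.minDegree_lt_card
  rw [Fintype.card_fin] at hlt
  rw [one_mul, Nat.cast_le] at h
  omega

theorem fractionalThreshold_nonneg (F : SimpleGraph W) : 0 ≤ fractionalThreshold F :=
  Real.sInf_nonneg fun _ h => h.1.1

/-- The complete graph has edges, none of which lies in a copy of an edgeless graph. -/
theorem one_le_fractionalThreshold_bot [Fintype W] :
    1 ≤ fractionalThreshold (⊥ : SimpleGraph W) := by
  refine le_csInf ⟨1, one_mem_threshold_set _⟩ ?_
  rintro δ ⟨-, n₀, h⟩
  by_contra! hδ
  obtain ⟨N, hN⟩ := exists_nat_gt (1 / (1 - δ))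
  set n := n₀ + N + 2 with hn
  have hn0 : 1 ≤ (1 - δ) * n := by
    have h1 : (N : ℝ) ≤ n := by exact_mod_cast (by omega : N ≤ n)
    have h2 : 1 / (1 - δ) ≤ n := by linarith
    rwa [div_le_iff₀ (by linarith), mul_comm] at h2
  obtain ⟨φ, hφ⟩ := h n (by omega) ⊤ (by
    rw [SimpleGraph.minDegree_top, Fintype.card_fin, Nat.cast_sub (by omega)]
    push_cast
    linarith)
  obtain ⟨ψ, -, hψ⟩ := hφ.exists_labelled
  have hsum := hψ.total (⟨0, by omega⟩ : Fin n) ⟨1, by omega⟩ (by simp)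
  classical
  rw [Finset.sum_eq_zero] at hsum
  · exact zero_ne_one hsum
  · intro f hf
    obtain ⟨u, v, huv, -⟩ := SimpleGraph.copyAlong_adj.1 (Finset.mem_filter.1 hf).2
    exact absurd huv (by simp)

theorem exists_decomposesAbove [Fintype W] (F : SimpleGraph W) {ε : ℝ} (hε : 0 < ε) :
    ∃ δ : ℝ, δ < fractionalThreshold F + ε ∧
      ∃ m₀ : ℕ, ∀ m ≥ m₀, DecomposesAbove F (Fin m) (δ * m) := by
  obtain ⟨δ, ⟨-, m₀, h⟩, hlt⟩ := exists_lt_of_csInf_lt ⟨1, one_mem_threshold_set F⟩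
    (lt_add_of_pos_right (fractionalThreshold F) hε)
  refine ⟨δ, hlt, m₀ + 1, fun m hm G hG => ?_⟩
  classical
  have : Nonempty (Fin m) := ⟨⟨0, by omega⟩⟩
  obtain ⟨φ, hφ⟩ := h m (by omega) G (by
    obtain ⟨v, hv⟩ := G.exists_minimal_degree_vertex
    rw [hv, ← SimpleGraph.ncard_neighborSet_eq_degree]
    exact hG v)
  exact hφ.exists_labelled

/-- The failure probability of a random sample is exponentially small in `m`, while the gadgets
tolerate a polynomially small one. -/
theorem exists_sampleSize (k m₀ : ℕ) {ε : ℝ} (hε : 0 < ε) :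
    ∃ m : ℕ, m₀ ≤ m ∧ (k : ℝ) ≤ ε / 4 * m ∧
      m * Real.exp (k + 1 - ε ^ 2 / 16 * m) ≤ 1 / (4 * (m : ℝ) ^ (k + 2)) := by
  have hb : 0 < ε ^ 2 / 16 := by positivity
  have h1 : ∀ᶠ x : ℝ in Filter.atTop, ‖x ^ (k + 3)‖ ≤
      1 / (4 * Real.exp (k + 1)) * ‖Real.exp (ε ^ 2 / 16 * x)‖ :=
    (isLittleO_pow_exp_pos_mul_atTop _ hb).def (by positivity)
  have h2 : ∀ᶠ x : ℝ in Filter.atTop, (k : ℝ) / (ε / 4) ≤ x := Filter.eventually_ge_atTop _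
  obtain ⟨m, ⟨h1, h2⟩, h3⟩ := ((tendsto_natCast_atTop_atTop.eventually (h1.and h2)).and
    (Filter.eventually_ge_atTop (m₀ + 1))).exists
  have hm : (0 : ℝ) < m := by exact_mod_cast (by omega : 0 < m)
  refine ⟨m, by omega, ?_, ?_⟩
  · rw [div_le_iff₀ (by positivity)] at h2
    linarith
  · rw [Real.norm_of_nonneg (by positivity), Real.norm_of_nonneg (by positivity)] at h1
    rw [le_div_iff₀ (by positivity), Real.exp_sub]
    have he := Real.exp_pos ((k : ℝ) + 1)
    have he' := Real.exp_pos (ε ^ 2 / 16 * (m : ℝ))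
    calc m * (Real.exp (k + 1) / Real.exp (ε ^ 2 / 16 * m)) * (4 * (m : ℝ) ^ (k + 2))
        = (m : ℝ) ^ (k + 3) * (4 * Real.exp (k + 1) / Real.exp (ε ^ 2 / 16 * m)) := by ring
      _ ≤ 1 / (4 * Real.exp (k + 1)) * Real.exp (ε ^ 2 / 16 * m) *
          (4 * Real.exp (k + 1) / Real.exp (ε ^ 2 / 16 * m)) := by gcongr
      _ = 1 := by field_simp

theorem choose_bounds {n k : ℕ} (hk : 2 ≤ k) (hn : 2 * k ≤ n) :
    ((n : ℝ) / 2) ^ (k - 2) / (k - 2).factorial ≤ ((n - 2).choose (k - 2) : ℝ) ∧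
      ((n - 2).choose (k - 2) : ℝ) ≤ (n : ℝ) ^ (k - 2) := by
  constructor
  · refine le_trans ?_ (Nat.pow_le_choose (k - 2) (n - 2))
    gcongr
    have : n ≤ 2 * (n - 2 + 1 - (k - 2)) := by omega
    have : (n : ℝ) ≤ 2 * ((n - 2 + 1 - (k - 2) : ℕ) : ℝ) := by exact_mod_cast this
    linarith
  · have h : (n - 2).choose (k - 2) ≤ n ^ (k - 2) :=
      (Nat.choose_le_pow _ _).trans (Nat.pow_le_pow_left (Nat.sub_le _ _) _)
    exact_mod_cast h

open Classical in
/-- The decomposition of `G` obtained from samples of a fixed size `m`, with both bounds on its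
weights of order `n ^ (2 - v(F))`. -/
theorem exists_bounded_decomposition [Fintype W] {F : SimpleGraph W} (hF : F ≠ ⊥) {ε : ℝ}
    (hε : 0 < ε) (hp1 : fractionalThreshold F + ε ≤ 1) :
    ∃ m : ℕ, 2 ≤ Fintype.card W ∧ Fintype.card W ≤ m ∧ ∃ n₀ : ℕ, ∀ n ≥ n₀,
      ∀ (G : SimpleGraph (Fin n)) [DecidableRel G.Adj],
        (fractionalThreshold F + ε) * (n : ℝ) ≤ (G.minDegree : ℝ) →
          ∃ φ : GraphCopies F G → ℝ, IsFractionalDecomposition F G φ ∧ ∀ H,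
            1 / (2 * (m : ℝ) ^ Fintype.card W) * (1 / 2 * (n : ℝ) ^ (m - Fintype.card W)) /
              ((m * (m - 1) : ℕ) * (n : ℝ) ^ (m - 2)) ≤ φ H ∧
            φ H ≤ (Fintype.card W : ℝ) ^ Fintype.card W * ((m : ℝ) ^ Fintype.card W *
              ((n : ℝ) ^ (m - Fintype.card W) * 2) / ((m * (m - 1) : ℕ) * (n : ℝ) ^ (m - 2))) := by
  set k := Fintype.card W with hk
  have hk2 : 2 ≤ k := by
    obtain ⟨u, v, huv⟩ := SimpleGraph.ne_bot_iff_exists_adj.1 hF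
    have : Nontrivial W := ⟨u, v, huv.ne⟩
    exact Fintype.one_lt_card
  set p := fractionalThreshold F + ε with hp
  have hp0 : 0 ≤ p := add_nonneg (fractionalThreshold_nonneg F) hε.le
  obtain ⟨δ, hδ, m₀, hm₀⟩ := exists_decomposesAbove F (by positivity : 0 < ε / 4)
  obtain ⟨m, hm, hkm, hexp⟩ := exists_sampleSize k (m₀ + k) hε
  have hk_le : k ≤ m := by omega
  have hm1 : (1 : ℝ) ≤ m := by exact_mod_cast (by omega : 1 ≤ m)
  have hm0 : (0 : ℝ) < m := by linarith
  -- chosen so that `m ^ 2 * (2 * κ) = 1 / m ^ k`, the tolerance of the gadgets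
  set κ : ℝ := 1 / (2 * (m : ℝ) ^ (k + 2)) with hκ
  have hκpos : 0 < κ := by positivity
  have hκ2 : κ ≤ 1 / 2 := by
    rw [hκ]
    have : (1 : ℝ) ≤ (m : ℝ) ^ (k + 2) := one_le_pow₀ hm1
    gcongr; linarith
  obtain ⟨n₁, hn₁⟩ := exists_nat_ge (2 * (m : ℝ) ^ 2 / κ)
  refine ⟨m, hk2, hk_le, n₁ + 1, fun n hn G _ hmin => ?_⟩
  have hn1 : (1 : ℝ) ≤ n := by exact_mod_cast (by omega : 1 ≤ n)
  have hn0 : (0 : ℝ) < n := by linarith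
  have : Nonempty (Fin n) := ⟨⟨0, by omega⟩⟩
  have hemb : Nonempty (W ↪ Fin m) := Function.Embedding.nonempty_of_card_le (by simpa using hk_le)
  have hL : (Fintype.card (W ↪ Fin m) : ℝ) ≤ (m : ℝ) ^ k := by
    have := Fintype.card_le_of_injective (fun f : W ↪ Fin m => (⇑f : W → Fin m))
      DFunLike.coe_injective
    rw [Fintype.card_fun, Fintype.card_fin] at this
    exact_mod_cast this
  have hL0 : (0 : ℝ) < (Fintype.card (W ↪ Fin m) : ℝ) := by exact_mod_cast Fintype.card_pos
  have hκn : (m : ℝ) ^ 2 / n + m * Real.exp (k + 1 - ε ^ 2 / 16 * m) ≤ κ := by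
    have h1 : (m : ℝ) ^ 2 / n ≤ κ / 2 := by
      have h : 2 * (m : ℝ) ^ 2 / κ ≤ n := hn₁.trans (by exact_mod_cast (by omega : n₁ ≤ n))
      rw [div_le_iff₀ hκpos] at h
      rw [div_le_iff₀ hn0]
      linarith
    have h2 : 1 / (4 * (m : ℝ) ^ (k + 2)) = κ / 2 := by rw [hκ]; field_simp; norm_num
    linarith
  have hdeg : ∀ v, p * Fintype.card (Fin n) ≤ ((G.neighborSet v).ncard : ℝ) := fun v => by
    rw [SimpleGraph.ncard_neighborSet_eq_degree, Fintype.card_fin]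
    exact hmin.trans (by exact_mod_cast G.minDegree_le_degree v)
  have hcast : (k : ℝ) = (Fintype.card W : ℝ) := rfl
  set S := goodEmbeddings (Fin m) G ((p - ε / 2) * Fintype.card (Fin m)) with hS
  obtain ⟨Ψ, hΨ, hΨb⟩ := exists_labelledDecomposition_of_sample (F := F) (G := G) (S := S) (κ := κ)
    (c := 1 / (2 * (Fintype.card (W ↪ Fin m) : ℝ))) hk2 hκ2 (by positivity) (by
      intro A a hA ha
      refine le_trans ?_ (card_goodEmbeddings_extending_ge G hε.le hp0 hp1 hdeg ha hA)
      simp only [Fintype.card_fin]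
      gcongr) (by
      intro g hg w hsymm hw
      refine (hm₀ m (by omega)).exists_weighted hF hk2 (fun i => ?_) hsymm hw ?_
      · have hgi := mem_goodEmbeddings.1 hg i
        rw [Fintype.card_fin] at hgi
        refine le_trans ?_ hgi
        have : δ * m ≤ (p - 3 * ε / 4) * m := by
          gcongr; linarith
        rw [← hcast]
        linarith
      · rw [Fintype.card_fin, hκ]
        calc (m : ℝ) ^ 2 * (2 * (1 / (2 * (m : ℝ) ^ (k + 2)))) = 1 / (m : ℝ) ^ k := by
              field_simp; ring
          _ ≤ _ := by gcongr)
  simp only [Fintype.card_fin] at hΨb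
  have hm10 : (0 : ℝ) ≤ (m * (m - 1) : ℕ) := Nat.cast_nonneg _
  obtain ⟨φ, hφ, hb⟩ := hΨ.exists_fractional (fun f => (hΨb f).1)
    (lo := 1 / (2 * (m : ℝ) ^ k) * (1 / 2 * (n : ℝ) ^ (m - k)) /
              ((m * (m - 1) : ℕ) * (n : ℝ) ^ (m - 2)))
    (hi := (m : ℝ) ^ k * ((n : ℝ) ^ (m - k) * 2) / ((m * (m - 1) : ℕ) * (n : ℝ) ^ (m - 2)))
    (fun f hf => by
      refine le_trans ?_ ((hΨb f).2.1 hf)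
      gcongr
      linarith)
    (fun f => by
      refine (hΨb f).2.2.trans ?_
      gcongr)
  exact ⟨φ, hφ, hb⟩

end Threshold

theorem mainTheorem4 {W : Type*} [Fintype W] (F : SimpleGraph W) (ε : ℝ)
    (hε : ε ∈ Set.Ioo (0 : ℝ) 1) :
    ∃ σ ∈ Set.Ioo (0 : ℝ) 1, ∃ C : ℕ, 1 ≤ C ∧ ∃ n₀ : ℕ, ∀ n : ℕ, n₀ ≤ n →
      ∀ (G : SimpleGraph (Fin n)) [DecidableRel G.Adj],
        (fractionalThreshold F + ε) * (n : ℝ) ≤ (G.minDegree : ℝ) →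
          ∃ φ : GraphCopies F G → ℝ,
            IsFractionalDecomposition F G φ ∧ IsBalanced F G σ (C : ℝ) φ := by
  have hε0 := hε.1
  by_cases hp : 1 < fractionalThreshold F + ε
  · refine ⟨1 / 2, by norm_num, 1, le_rfl, 1, fun n hn G _ hmin => ?_⟩
    have : Nonempty (Fin n) := ⟨⟨0, hn⟩⟩
    have hlt : (G.minDegree : ℝ) < n := by
      have := G.minDegree_lt_card
      rw [Fintype.card_fin] at this
      exact_mod_cast this
    have hn0 : (0 : ℝ) < n := by exact_mod_cast hn
    nlinarith
  have hF : F ≠ ⊥ := by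
    rintro rfl
    linarith [one_le_fractionalThreshold_bot (W := W)]
  obtain ⟨m, hk2, hkm, n₀, h⟩ := exists_bounded_decomposition hF hε0 (not_lt.1 hp)
  set k := Fintype.card W with hk
  have hm1 : (1 : ℝ) ≤ m := by exact_mod_cast (by omega : 1 ≤ m)
  set M : ℝ := ((m * (m - 1) : ℕ) : ℝ) with hM
  have hM1 : 1 ≤ M := by
    rw [hM]
    exact_mod_cast Nat.mul_pos (by omega : 0 < m) (by omega : 0 < m - 1)
  set D : ℝ := 2 * (m : ℝ) ^ k * 2 * M * (2 ^ (k - 2) * (k - 2).factorial) with hD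
  have hf1 : (1 : ℝ) ≤ (k - 2).factorial := by exact_mod_cast Nat.factorial_pos _
  have hD2 : 1 < D := by
    have h1 : (1 : ℝ) ≤ (m : ℝ) ^ k := one_le_pow₀ hm1
    have h2 : (1 : ℝ) ≤ 2 ^ (k - 2) := one_le_pow₀ one_le_two
    have h3 : 1 ≤ (m : ℝ) ^ k * M * (2 ^ (k - 2) * (k - 2).factorial) :=
      one_le_mul_of_one_le_of_one_le (one_le_mul_of_one_le_of_one_le h1 hM1)
        (one_le_mul_of_one_le_of_one_le h2 hf1)
    rw [hD]; linarith
  obtain ⟨C, hC⟩ := exists_nat_ge ((k : ℝ) ^ k * ((m : ℝ) ^ k * 2 / M))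
  refine ⟨1 / D, ⟨by positivity, by rw [div_lt_one (by linarith)]; exact hD2⟩, C + 1, by omega,
    n₀ + 2 * k, fun n hn G _ hmin => ?_⟩
  obtain ⟨φ, hφ, hb⟩ := h n (by omega) G hmin
  refine ⟨φ, hφ, fun H => ?_⟩
  obtain ⟨hlo, hhi⟩ := hb H
  have hn0 : (0 : ℝ) < n := by exact_mod_cast (by omega : 0 < n)
  obtain ⟨hch1, hch2⟩ := choose_bounds hk2 (by omega : 2 * k ≤ n)
  rw [Fintype.card_fin, ← hk]
  have hpow : (n : ℝ) ^ (m - 2) = (n : ℝ) ^ (m - k) * (n : ℝ) ^ (k - 2) := by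
    rw [← pow_add]; congr 1; omega
  have hx : (n : ℝ) ^ (m - k) ≠ 0 := by positivity
  have hy : (n : ℝ) ^ (k - 2) ≠ 0 := by positivity
  rw [hpow] at hlo hhi
  have hhi0 : (0 : ℝ) ≤ (n - 2).choose (k - 2) := Nat.cast_nonneg _
  constructor
  · calc 1 / D = 1 / (2 * (m : ℝ) ^ k) * (1 / 2 * (n : ℝ) ^ (m - k)) /
            (M * ((n : ℝ) ^ (m - k) * (n : ℝ) ^ (k - 2))) *
            (((n : ℝ) / 2) ^ (k - 2) / (k - 2).factorial) := by
          rw [hD, div_pow]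
          field_simp
      _ ≤ _ := mul_le_mul hlo hch1 (by positivity) (hφ.nonneg H)
  · calc _ ≤ (k : ℝ) ^ k * ((m : ℝ) ^ k * ((n : ℝ) ^ (m - k) * 2) /
            (M * ((n : ℝ) ^ (m - k) * (n : ℝ) ^ (k - 2)))) * (n : ℝ) ^ (k - 2) :=
          mul_le_mul hhi hch2 hhi0 (by positivity)
      _ = (k : ℝ) ^ k * ((m : ℝ) ^ k * 2 / M) := by field_simp
      _ ≤ _ := by push_cast; linarith
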